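/- For a group $G$ and a prime $p$, let $b_1(G;\mathbb{F}_p)=\dim_{\mathbb{F}_p}H_1(G;\mathbb{F}_p)$. The deficiency of a finite presentation with $n$ generators and $m$ relators is $n-m$, and the deficiency of a finitely presentable group $G$ is the maximum of the deficiencies of its finite presentations. Let $G$ be a finitely presentable group with deficiency at least $1$, let $p$ be a prime and let $r\ge 1$ be an integer. Then for every normal subgroup $N$ of $G$ with $G/N\cong(\mathbb{Z}/p\mathbb{Z})^r$, $$b_1(N;\mathbb{F}_p)\ \ge\ 2^{r-1}.$$ Moreover, if $b_1(N;\mathbb{F}_p)=2^{r-1}$, then $b_1(G;\mathbb{F}_p)=r$ and $r\in\{1,2\}$. -/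

import Mathlib

universe u

/-- A finite presentation `⟨a₁, …, aₙ | R₁, …, Rₘ⟩` of the group `G`: the relators form a finite
family of words in the free group on `n` letters, and `G` is identified with the quotient of that
free group by the normal closure of the relators. -/
structure FinitePresentation (G : Type u) [Group G] where
  /-- the number `n` of generators -/
  numGens : ℕ
  /-- the number `m` of relators -/
  numRels : ℕ
  /-- the relators `R₁, …, Rₘ` -/
  rel : Fin numRels → FreeGroup (Fin numGens)
  /-- the identification of the presented group with `G` -/
  iso : PresentedGroup (Set.range rel) ≃* G

/-- The deficiency `n - m` (an integer) of a finite presentation with `n` generators and `m`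
relators. -/
def FinitePresentation.deficiency {G : Type u} [Group G] (P : FinitePresentation G) : ℤ :=
  (P.numGens : ℤ) - (P.numRels : ℤ)

/-- The deficiency of `G`: the largest deficiency of a finite presentation of `G`. It is formed as
a supremum in the extended reals, so that no junk value can occur: it is `⊥` exactly
if `G` has no finite presentation. -/
noncomputable def groupDeficiency (G : Type u) [Group G] : EReal :=
  ⨆ P : FinitePresentation G, ((P.deficiency : ℝ) : EReal)

/-- The deficiency of `G` is at least `d` if and only if some finite presentation of `G` has
deficiency at least `d`. -/
theorem le_groupDeficiency_iff (G : Type u) [Group G] (d : ℤ) :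
    ((d : ℝ) : EReal) ≤ groupDeficiency G ↔ ∃ P : FinitePresentation G, d ≤ P.deficiency := by
  constructor
  · intro h
    by_contra! hP
    have h1 : groupDeficiency G ≤ (((d - 1 : ℤ) : ℝ) : EReal) := by
      refine iSup_le fun P => ?_
      have := hP P
      exact EReal.coe_le_coe_iff.2 (Int.cast_le.2 (by omega))
    have h2 := EReal.coe_le_coe_iff.1 (h.trans h1)
    have h3 : d ≤ d - 1 := by exact_mod_cast h2
    omega
  · rintro ⟨P, hP⟩
    refine le_trans (EReal.coe_le_coe_iff.2 (Int.cast_le.2 hP)) ?_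
    exact le_iSup (fun P : FinitePresentation G => ((P.deficiency : ℝ) : EReal)) P

/-- The first Betti number `b₁(G; 𝔽ₚ) = dim H₁(G; 𝔽ₚ)`: the dimension over `𝔽ₚ` of the first
homology group of `G` with coefficients in the trivial representation `𝔽ₚ`. The field `𝔽ₚ` is
lifted to the universe of `G`, as Mathlib's group homology asks for. -/
noncomputable def firstBetti (p : ℕ) (G : Type u) [Group G] : ℕ :=
  Module.finrank (ULift.{u} (ZMod p))
    (groupHomology (Rep.trivial (ULift.{u} (ZMod p)) G (ULift.{u} (ZMod p))) 1)

/-- The crossed homomorphisms (1-cocycles) of `G` with values in a representation. -/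
def crossedHom {k G M : Type*} [CommRing k] [Group G] [AddCommGroup M] [Module k M]
    (ρ : Representation k G M) : Submodule k (G → M) where
  carrier := {c | ∀ g h, c (g * h) = c g + ρ g (c h)}
  zero_mem' := by intro g h; simp
  add_mem' := by
    intro a b ha hb g h
    simp only [Pi.add_apply, ha g h, hb g h, map_add]
    abel
  smul_mem' := by
    intro t a ha g h
    simp only [Pi.smul_apply, ha g h, map_smul, smul_add]

theorem mem_crossedHom {k G M : Type*} [CommRing k] [Group G] [AddCommGroup M] [Module k M]
    {ρ : Representation k G M} {c : G → M} :
    c ∈ crossedHom ρ ↔ ∀ g h, c (g * h) = c g + ρ g (c h) := Iff.rfl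

open TensorProduct in
/-- If `V` is the extension of scalars of `Gᵃᵇ` to a prime field `K`, the dual of `V` is the space
of homomorphisms from `G` to the field. -/
theorem finrank_eq_finrank_crossedHom_of_tensor {p : ℕ} [Fact p.Prime] {G K V : Type*} [Group G]
    [Field K] (σ : K ≃+* ZMod p) [AddCommGroup V] [Module K V]
    (e : V ≃+ Additive (Abelianization G) ⊗[ℤ] K) :
    Module.finrank K V =
      Module.finrank (ZMod p) (crossedHom (Representation.trivial (ZMod p) G (ZMod p))) := by
  have hint : ∀ c : K, ∃ z : ℤ, (z : K) = c := fun c => by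
    obtain ⟨z, hz⟩ := ZMod.intCast_surjective (σ c)
    exact ⟨z, σ.injective (by simpa using hz)⟩
  let cls : G → V := fun g => e.symm (Additive.ofMul (Abelianization.of g) ⊗ₜ[ℤ] (1 : K))
  have hcls : ∀ g h, cls (g * h) = cls g + cls h := fun g h => by
    simp only [cls, map_mul, ofMul_mul, TensorProduct.add_tmul, map_add]
  let j₀ : Module.Dual K V →+ crossedHom (Representation.trivial (ZMod p) G (ZMod p)) :=
    { toFun := fun φ => ⟨fun g => σ (φ (cls g)), fun g h => by
        simp [hcls]⟩
      map_zero' := by ext; simp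
      map_add' := fun _ _ => by ext; simp }
  have hinj : Function.Injective j₀ := by
    rw [injective_iff_map_eq_zero]
    intro φ hφ
    have h1 : ∀ g, φ (cls g) = 0 := fun g => by
      have := congrFun (congrArg Subtype.val hφ) g
      exact σ.injective (by simpa [j₀] using this)
    have h2 : ∀ t, φ (e.symm t) = 0 := fun t => by
      induction t using TensorProduct.induction_on with
      | zero => simp
      | add x y hx hy => rw [map_add, map_add, hx, hy, add_zero]
      | tmul x y =>
        obtain ⟨z, rfl⟩ := hint y
        obtain ⟨g, hg⟩ := QuotientGroup.mk_surjective (Additive.toMul x)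
        have hx : x = Additive.ofMul (Abelianization.of g) := by
          exact hg.symm
        have : x ⊗ₜ[ℤ] (z : K) = z • (x ⊗ₜ[ℤ] (1 : K)) := by
          rw [← TensorProduct.tmul_smul, zsmul_one]
        rw [this, map_zsmul, map_zsmul, hx, h1 g, smul_zero]
    ext v
    simpa using h2 (e v)
  have hsurj : Function.Surjective j₀ := by
    rintro ⟨u, hu⟩
    have hu' : ∀ g h, u (g * h) = u g + u h := by simpa [mem_crossedHom] using hu
    let a : Additive (Abelianization G) →+ K :=
      MonoidHom.toAdditiveLeft (Abelianization.lift
        ({ toFun := fun g => Multiplicative.ofAdd (σ.symm (u g))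
           map_one' := by
            have := hu' 1 1
            simp only [mul_one, left_eq_add] at this
            simp [this]
           map_mul' := fun g h => by simp [hu'] } : G →* Multiplicative K))
    let φ : V →+ K := (TensorProduct.lift
        ((LinearMap.mul ℤ K).comp a.toIntLinearMap)).toAddMonoidHom.comp e.toAddMonoidHom
    let φ' : Module.Dual K V :=
      { φ with
        map_smul' := fun c v => by
          obtain ⟨z, rfl⟩ := hint c
          change φ _ = _ • φ _
          rw [Int.cast_smul_eq_zsmul, map_zsmul, RingHom.id_apply, Int.cast_smul_eq_zsmul] }
    refine ⟨φ', ?_⟩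
    ext g
    change σ (φ (cls g)) = u g
    simp [φ, cls, a]
  rw [← Subspace.dual_finrank_eq]
  have := lift_rank_eq_of_equiv_equiv σ (AddEquiv.ofBijective j₀ ⟨hinj, hsurj⟩) σ.bijective
    (fun c φ => by
      ext g
      change σ (c • φ (cls g)) = σ c * σ (φ (cls g))
      rw [smul_eq_mul, map_mul])
  simpa [Module.finrank] using congrArg Cardinal.toNat this

theorem firstBetti_eq_finrank_crossedHom (p : ℕ) [Fact p.Prime] (G : Type u) [Group G] :
    firstBetti p G =
      Module.finrank (ZMod p) (crossedHom (Representation.trivial (ZMod p) G (ZMod p))) :=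
  finrank_eq_finrank_crossedHom_of_tensor ULift.ringEquiv
    (groupHomology.H1AddEquivOfIsTrivial
      (Rep.trivial (ULift.{u} (ZMod p)) G (ULift.{u} (ZMod p))))

section CrossedHom

variable {k G M : Type*} [CommRing k] [Group G] [AddCommGroup M] [Module k M]
  {ρ : Representation k G M} {c : G → M}

theorem crossedHom_one (hc : c ∈ crossedHom ρ) : c 1 = 0 := by
  simpa using hc 1 1

theorem crossedHom_inv (hc : c ∈ crossedHom ρ) (g : G) : c g⁻¹ = -ρ g⁻¹ (c g) := by
  have := hc g⁻¹ g
  rw [inv_mul_cancel, crossedHom_one hc] at this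
  exact eq_neg_of_add_eq_zero_left this.symm

theorem comp_mem_crossedHom {H : Type*} [Group H] (q : H →* G) (hc : c ∈ crossedHom ρ) :
    c ∘ q ∈ crossedHom (ρ.comp q) := fun g h => by
  simp [hc (q g) (q h)]

end CrossedHom

section FreeGroup

variable {k X M : Type*} [CommRing k] [AddCommGroup M] [Module k M]
  (ρ : Representation k (FreeGroup X) M)

theorem crossedHom_freeGroup_eq_zero {c : FreeGroup X → M} (hc : c ∈ crossedHom ρ)
    (h : ∀ x, c (FreeGroup.of x) = 0) : c = 0 := by
  funext g
  induction g using FreeGroup.induction_on with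
  | C1 => exact crossedHom_one hc
  | of x => exact h x
  | inv_of x _ =>
    change c (FreeGroup.of x)⁻¹ = 0
    rw [crossedHom_inv hc, h x, map_zero, neg_zero]
  | mul g h hg hh => rw [hc, hg, hh]; simp

/-- The affine permutation `m ↦ v x + x • m`. -/
def affinePerm (v : X → M) (x : X) : Equiv.Perm M where
  toFun m := v x + ρ (FreeGroup.of x) m
  invFun m := ρ (FreeGroup.of x)⁻¹ (m - v x)
  left_inv m := by simp
  right_inv m := by simp

theorem lift_affinePerm_apply (v : X → M) (g : FreeGroup X) (m : M) :
    FreeGroup.lift (affinePerm ρ v) g m = FreeGroup.lift (affinePerm ρ v) g 0 + ρ g m := by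
  induction g using FreeGroup.induction_on generalizing m with
  | C1 => simp
  | of x => simp [affinePerm]
  | inv_of x _ =>
    rw [map_inv, FreeGroup.lift_apply_of]
    change ρ (FreeGroup.of x)⁻¹ (m - v x) = ρ (FreeGroup.of x)⁻¹ (0 - v x) + _
    rw [← map_add]
    congr 1
    abel
  | mul g h hg hh =>
    simp only [map_mul, Equiv.Perm.mul_apply, Module.End.mul_apply]
    rw [hg, hh, hg (FreeGroup.lift (affinePerm ρ v) h 0), map_add, add_assoc]

theorem exists_crossedHom_freeGroup (v : X → M) :
    ∃ c ∈ crossedHom ρ, ∀ x, c (FreeGroup.of x) = v x := by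
  refine ⟨fun g => FreeGroup.lift (affinePerm ρ v) g 0, fun g h => ?_, fun x => ?_⟩
  · simp only [map_mul, Equiv.Perm.mul_apply]
    exact lift_affinePerm_apply ρ v g _
  · simp [affinePerm]

/-- A crossed homomorphism on a free group is determined by arbitrary values on the generators. -/
noncomputable def crossedHomFreeGroupEquiv : crossedHom ρ ≃ₗ[k] (X → M) :=
  LinearEquiv.ofBijective
    ({ toFun := fun c x => c.1 (FreeGroup.of x)
       map_add' := fun _ _ => rfl
       map_smul' := fun _ _ => rfl } : crossedHom ρ →ₗ[k] (X → M))
    ⟨(injective_iff_map_eq_zero _).2 fun c hc =>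
        Subtype.ext (crossedHom_freeGroup_eq_zero ρ c.2 fun x => congrFun hc x),
      fun v => by
        obtain ⟨c, hc, h⟩ := exists_crossedHom_freeGroup ρ v
        exact ⟨⟨c, hc⟩, funext h⟩⟩

theorem crossedHomFreeGroupEquiv_symm_of (v : X → M) (x : X) :
    ((crossedHomFreeGroupEquiv ρ).symm v).1 (FreeGroup.of x) = v x :=
  congrFun ((crossedHomFreeGroupEquiv ρ).apply_symm_apply v) x

end FreeGroup

namespace FinitePresentation

variable {G : Type u} [Group G] (P : FinitePresentation G)

/-- The projection of the free group on the generators onto the presented group. -/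
def proj : FreeGroup (Fin P.numGens) →* G :=
  P.iso.toMonoidHom.comp (PresentedGroup.mk (Set.range P.rel))

theorem proj_surjective : Function.Surjective P.proj :=
  P.iso.surjective.comp (PresentedGroup.mk_surjective _)

theorem proj_eq_one_iff (z : FreeGroup (Fin P.numGens)) :
    P.proj z = 1 ↔ z ∈ Subgroup.normalClosure (Set.range P.rel) := by
  change P.iso (PresentedGroup.mk _ z) = 1 ↔ _
  rw [map_eq_one_iff _ P.iso.injective]
  exact QuotientGroup.eq_one_iff z

theorem proj_rel (j : Fin P.numRels) : P.proj (P.rel j) = 1 :=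
  (P.proj_eq_one_iff _).2 (Subgroup.subset_normalClosure ⟨j, rfl⟩)

variable {k M : Type*} [AddCommGroup M]

theorem exists_crossedHom_of_rel [CommRing k] [Module k M] (ρ : Representation k G M)
    {c : FreeGroup (Fin P.numGens) → M}
    (hc : c ∈ crossedHom (ρ.comp P.proj)) (h : ∀ j, c (P.rel j) = 0) :
    ∃ c' ∈ crossedHom ρ, c' ∘ P.proj = c := by
  have hker : ∀ z, P.proj z = 1 → c z = 0 := by
    let K : Subgroup (FreeGroup (Fin P.numGens)) :=
      { carrier := {z | P.proj z = 1 ∧ c z = 0}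
        one_mem' := ⟨map_one _, crossedHom_one hc⟩
        mul_mem' := by
          rintro a b ⟨ha, ha'⟩ ⟨hb, hb'⟩
          exact ⟨by rw [map_mul, ha, hb, one_mul], by rw [hc, ha', hb', map_zero, zero_add]⟩
        inv_mem' := by
          rintro a ⟨ha, ha'⟩
          exact ⟨by rw [map_inv, ha, inv_one], by rw [crossedHom_inv hc, ha', map_zero, neg_zero]⟩ }
    have hK : K.Normal := ⟨by
      rintro z ⟨hz, hz'⟩ g
      refine ⟨by simp [hz], ?_⟩
      have h1 : ρ (P.proj (g * z)) = ρ (P.proj g) := by simp [hz]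
      rw [hc, hc, hz', map_zero, add_zero, crossedHom_inv hc, MonoidHom.comp_apply, h1]
      simp⟩
    intro z hz
    have : Subgroup.normalClosure (Set.range P.rel) ≤ K := Subgroup.normalClosure_le_normal (by
      rintro _ ⟨j, rfl⟩
      exact ⟨P.proj_rel j, h j⟩)
    exact (this ((P.proj_eq_one_iff z).1 hz)).2
  have heq : ∀ y z, P.proj y = P.proj z → c y = c z := fun y z hyz => by
    have h1 : c (y⁻¹ * z) = 0 := hker _ (by simp [hyz])
    have h2 := hc y (y⁻¹ * z)
    rw [h1, map_zero, add_zero, mul_inv_cancel_left] at h2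
    exact h2.symm
  let s := Function.surjInv P.proj_surjective
  have hs : ∀ g, P.proj (s g) = g := Function.surjInv_eq _
  refine ⟨fun g => c (s g), fun g h => ?_, funext fun z => heq _ _ (hs _)⟩
  change c (s (g * h)) = c (s g) + ρ g (c (s h))
  rw [heq (s (g * h)) (s g * s h) (by simp [hs]), hc]
  simp [hs]

variable [Field k] [Module k M] (ρ : Representation k G M)

/-- Pullback of crossed homomorphisms to the free group on the generators. -/
def pullback : crossedHom ρ →ₗ[k] crossedHom (ρ.comp P.proj) where
  toFun c := ⟨c.1 ∘ P.proj, comp_mem_crossedHom P.proj c.2⟩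
  map_add' _ _ := rfl
  map_smul' _ _ := rfl

theorem pullback_injective : Function.Injective (P.pullback ρ) := fun _ _ hab =>
  Subtype.ext (P.proj_surjective.injective_comp_right (congrArg Subtype.val hab))

theorem finiteDimensional_crossedHom_proj [FiniteDimensional k M] :
    FiniteDimensional k (crossedHom (ρ.comp P.proj)) :=
  (crossedHomFreeGroupEquiv (ρ.comp P.proj)).symm.finiteDimensional

theorem finiteDimensional_crossedHom (P : FinitePresentation G) [FiniteDimensional k M] :
    FiniteDimensional k (crossedHom ρ) :=
  have := P.finiteDimensional_crossedHom_proj ρ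
  FiniteDimensional.of_injective _ (P.pullback_injective ρ)

end FinitePresentation

namespace FinitePresentation

variable {G : Type u} [Group G] (P : FinitePresentation G)
variable {k M ι : Type*} [Field k] [AddCommGroup M] [Module k M] [Fintype ι]

/-- The values on the generators of the crossed homomorphism given by a family in `W` and by
homomorphisms `G → k` with coefficients `e i`. -/
def genValues (W : Submodule k M) (e : ι → M) :
    ((Fin P.numGens → W) × (ι → crossedHom (Representation.trivial k G k))) →ₗ[k]
      (Fin P.numGens → M) where
  toFun z x := z.1 x + ∑ i, (z.2 i).1 (P.proj (FreeGroup.of x)) • e i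
  map_add' y z := by
    ext x
    simp only [Prod.fst_add, Prod.snd_add, Pi.add_apply, Submodule.coe_add, add_smul,
      Finset.sum_add_distrib]
    abel
  map_smul' t z := by
    ext x
    simp [Finset.smul_sum, mul_smul]

variable (ρ : Representation k G M) (W : Submodule k M) (e : ι → M)

theorem genValues_injective (hind : ∀ a : ι → k, ∑ i, a i • e i ∈ W → a = 0) :
    Function.Injective (P.genValues W e) := by
  rw [injective_iff_map_eq_zero]
  rintro ⟨w, h⟩ hz
  have hx : ∀ x, (w x : M) + ∑ i, (h i).1 (P.proj (FreeGroup.of x)) • e i = 0 := congrFun hz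
  have h0 : ∀ x, (fun i => (h i).1 (P.proj (FreeGroup.of x))) = 0 := fun x => by
    refine hind _ ?_
    rw [eq_neg_of_add_eq_zero_right (hx x)]
    exact W.neg_mem (w x).2
  have hh : h = 0 := by
    funext i
    apply P.pullback_injective (Representation.trivial k G k)
    rw [Pi.zero_apply, map_zero]
    exact Subtype.ext (crossedHom_freeGroup_eq_zero _ (P.pullback _ (h i)).2
      fun x => congrFun (h0 x) i)
  subst hh
  have hw : w = 0 := by
    funext x
    exact Subtype.ext (by simpa using hx x)
  rw [hw]
  rfl

theorem crossedHom_genValues_sub_mem (hW : ∀ g, ∀ w ∈ W, ρ g w ∈ W)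
    (he : ∀ g i, ρ g (e i) - e i ∈ W)
    (z : (Fin P.numGens → W) × (ι → crossedHom (Representation.trivial k G k)))
    (g : FreeGroup (Fin P.numGens)) :
    ((crossedHomFreeGroupEquiv (ρ.comp P.proj)).symm (P.genValues W e z)).1 g -
      ∑ i, (z.2 i).1 (P.proj g) • e i ∈ W := by
  set C := (crossedHomFreeGroupEquiv (ρ.comp P.proj)).symm (P.genValues W e z) with hC
  have hadd : ∀ i (a b : G), (z.2 i).1 (a * b) = (z.2 i).1 a + (z.2 i).1 b := fun i a b => by
    simpa using (z.2 i).2 a b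
  have hone : ∀ i, (z.2 i).1 1 = 0 := fun i => crossedHom_one (z.2 i).2
  have hmul : ∀ a b : FreeGroup (Fin P.numGens),
      C.1 (a * b) - ∑ i, (z.2 i).1 (P.proj (a * b)) • e i =
      (C.1 a - ∑ i, (z.2 i).1 (P.proj a) • e i) +
      (ρ (P.proj a) (C.1 b - ∑ i, (z.2 i).1 (P.proj b) • e i) +
      ∑ i, (z.2 i).1 (P.proj b) • (ρ (P.proj a) (e i) - e i)) := fun a b => by
    rw [C.2 a b]
    simp only [MonoidHom.comp_apply, map_mul, hadd, add_smul, Finset.sum_add_distrib, map_sub,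
      map_sum, map_smul, smul_sub, Finset.sum_sub_distrib]
    abel
  have hsum : ∀ (a : G) (t : ι → k), ∑ i, t i • (ρ a (e i) - e i) ∈ W := fun a t =>
    W.sum_mem fun i _ => W.smul_mem _ (he a i)
  induction g using FreeGroup.induction_on with
  | C1 => simp [hone, crossedHom_one C.2]
  | of x =>
    change C.1 (FreeGroup.of x) - ∑ i, (z.2 i).1 (P.proj (FreeGroup.of x)) • e i ∈ W
    rw [hC, crossedHomFreeGroupEquiv_symm_of]
    simp [genValues]
  | inv_of x hx =>
    have h1 := hmul (FreeGroup.of x)⁻¹ (FreeGroup.of x)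
    simp only [inv_mul_cancel, map_one, hone, zero_smul, Finset.sum_const_zero, sub_zero,
      crossedHom_one C.2] at h1
    have h2 := eq_neg_of_add_eq_zero_left h1.symm
    change C.1 (FreeGroup.of x)⁻¹ - ∑ i, (z.2 i).1 (P.proj (FreeGroup.of x)⁻¹) • e i ∈ W
    rw [h2]
    exact W.neg_mem (W.add_mem (hW _ _ hx) (hsum _ _))
  | mul a b ha hb =>
    rw [hmul]
    exact W.add_mem ha (W.add_mem (hW _ _ hb) (hsum _ _))

/-- A lower bound for the dimension of the space of crossed homomorphisms into a representation
that has a section with trivial action. -/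
theorem finrank_crossedHom_ge [FiniteDimensional k M] (hW : ∀ g, ∀ w ∈ W, ρ g w ∈ W)
    (he : ∀ g i, ρ g (e i) - e i ∈ W) (hind : ∀ a : ι → k, ∑ i, a i • e i ∈ W → a = 0) :
    P.numGens * Module.finrank k W +
        Module.finrank k (crossedHom (Representation.trivial k G k)) * Fintype.card ι ≤
      Module.finrank k (crossedHom ρ) + P.numRels * Module.finrank k W := by
  have := P.finiteDimensional_crossedHom (Representation.trivial k G k)
  have := P.finiteDimensional_crossedHom_proj ρ
  let Φ := (crossedHomFreeGroupEquiv (ρ.comp P.proj)).symm.toLinearMap ∘ₗ P.genValues W e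
  have hΦ : Function.Injective Φ :=
    (crossedHomFreeGroupEquiv (ρ.comp P.proj)).symm.injective.comp (P.genValues_injective W e hind)
  let Ψ : ((Fin P.numGens → W) × (ι → crossedHom (Representation.trivial k G k))) →ₗ[k]
      (Fin P.numRels → W) :=
    LinearMap.pi fun j => LinearMap.codRestrict W
      (LinearMap.proj (P.rel j) ∘ₗ (crossedHom (ρ.comp P.proj)).subtype ∘ₗ Φ) fun z => by
        have h := P.crossedHom_genValues_sub_mem ρ W e hW he z (P.rel j)
        rw [P.proj_rel] at h
        simp only [crossedHom_one (z.2 _).2, zero_smul, Finset.sum_const_zero, sub_zero] at h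
        exact h
  have h1 := LinearMap.finrank_range_add_finrank_ker Ψ
  have h2 := Submodule.finrank_le (LinearMap.range Ψ)
  have h3 : Module.finrank k (LinearMap.ker Ψ) ≤ Module.finrank k (crossedHom ρ) := by
    rw [← LinearMap.finrank_range_of_inj (P.pullback_injective ρ),
      ← LinearMap.finrank_range_of_inj
        (f := Φ ∘ₗ (LinearMap.ker Ψ).subtype) (hΦ.comp Subtype.val_injective)]
    refine Submodule.finrank_mono ?_
    rintro _ ⟨⟨z, hz⟩, rfl⟩
    obtain ⟨c, hc, hcz⟩ := P.exists_crossedHom_of_rel ρ (Φ z).2 fun j =>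
      congrArg Subtype.val (congrFun (LinearMap.mem_ker.1 hz) j)
    exact ⟨⟨c, hc⟩, Subtype.ext hcz⟩
  simp only [Module.finrank_prod, Module.finrank_pi_fintype, Finset.sum_const, Finset.card_univ,
    Fintype.card_fin, smul_eq_mul] at h1 h2
  rw [mul_comm (Module.finrank k (crossedHom _)) (Fintype.card ι)]
  omega

end FinitePresentation

/-- The representation of `G` on the functions on an additive group by translations. -/
def translationRep (k : Type*) {G A : Type*} [Field k] [Group G] [AddCommGroup A]
    (π : G →* Multiplicative A) : Representation k G (A → k) where
  toFun g :=
    { toFun := fun f x => f (x + (π g).toAdd)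
      map_add' := fun _ _ => rfl
      map_smul' := fun _ _ => rfl }
  map_one' := by ext; simp
  map_mul' g h := by
    apply LinearMap.ext
    intro f
    funext x
    simp [add_assoc]

/-- The inequality of Shapiro's lemma: crossed homomorphisms into the coinduced module, modulo
inner ones, embed into the homomorphisms of the kernel. -/
theorem finrank_crossedHom_translationRep_lt {k G A : Type*} [Field k] [Group G] [AddCommGroup A]
    [Fintype A] (π : G →* Multiplicative A) (hπ : Function.Surjective π) (N : Subgroup G)
    (hN : ∀ g, g ∈ N ↔ π g = 1)
    [FiniteDimensional k (crossedHom (Representation.trivial k N k))] :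
    Module.finrank k (crossedHom (translationRep k π)) <
      Module.finrank k (crossedHom (Representation.trivial k N k)) + Fintype.card A := by
  classical
  let s := Function.surjInv hπ
  have hs : ∀ a, π (s a) = a := Function.surjInv_eq hπ
  have hN1 : ∀ n ∈ N, π n = 1 := fun n hn => (hN n).1 hn
  have hc : ∀ (c : crossedHom (translationRep k π)) (g h : G) (x : A),
      c.1 (g * h) x = c.1 g x + c.1 h (x + (π g).toAdd) := fun c g h x => congrFun (c.2 g h) x
  let R : crossedHom (translationRep k π) →ₗ[k]
      crossedHom (Representation.trivial k N k) × (A → k) :=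
    { toFun := fun c => (⟨fun n => c.1 n 0, fun m n => by
        simp [hc, hN1 m m.2]⟩, fun a => c.1 (s (Multiplicative.ofAdd a)) 0)
      map_add' := fun _ _ => rfl
      map_smul' := fun _ _ => rfl }
  have hR : ∀ c, (R c).1 = 0 → ∀ g h, π g = π h → c.1 g 0 = c.1 h 0 := fun c h1 g h hgh => by
    have hn : g * h⁻¹ ∈ N := (hN _).2 (by simp [hgh])
    have h2 := hc c (g * h⁻¹) h 0
    rw [inv_mul_cancel_right, hN1 _ hn] at h2
    have h3 : c.1 (g * h⁻¹) 0 = 0 := congrFun (congrArg Subtype.val h1) ⟨_, hn⟩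
    simpa [h3] using h2
  have hinj : Function.Injective R := by
    rw [injective_iff_map_eq_zero]
    intro c h0
    have h1 : (R c).1 = 0 := by rw [h0]; rfl
    have h2 : ∀ g, c.1 g 0 = 0 := fun g => by
      rw [hR c h1 g (s (π g)) (hs _).symm]
      exact congrFun (congrArg Prod.snd h0) (π g).toAdd
    refine Subtype.ext (funext fun g => funext fun x => ?_)
    have h3 := hc c (s (Multiplicative.ofAdd x)) g 0
    rw [h2, h2, hs] at h3
    simpa using h3.symm
  have hne : LinearMap.range R ≠ ⊤ := fun h => by
    obtain ⟨c, h1⟩ := LinearMap.range_eq_top.1 h (0, Pi.single 0 1)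
    have h2 : c.1 (s (Multiplicative.ofAdd 0)) 0 = 1 := by
      have := congrFun (congrArg Prod.snd h1) 0
      simpa [R] using this
    rw [hR c (congrArg Prod.fst h1) _ 1 (by rw [hs]; simp), crossedHom_one c.2] at h2
    exact zero_ne_one h2
  have := Submodule.finrank_lt hne
  rwa [LinearMap.finrank_range_of_inj hinj, Module.finrank_prod, Module.finrank_fintype_fun_eq_card]
    at this

theorem card_finset_card_le {ι : Type*} [Fintype ι] (d : ℕ) :
    Fintype.card {T : Finset ι // T.card ≤ d} =
      ∑ j ∈ Finset.range (d + 1), (Fintype.card ι).choose j := by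
  rw [Fintype.card_subtype, Finset.card_eq_sum_card_fiberwise (t := Finset.range (d + 1))
    (f := Finset.card) (by intro T hT; simpa [Nat.lt_succ_iff] using hT)]
  refine Finset.sum_congr rfl fun j hj => ?_
  rw [← Finset.card_univ, ← Finset.card_powersetCard]
  congr 1
  ext T
  simp only [Finset.mem_filter, Finset.mem_univ, true_and, Finset.mem_powersetCard,
    Finset.subset_univ, and_iff_right_iff_imp]
  rintro rfl
  exact Nat.lt_succ_iff.1 (Finset.mem_range.1 hj)

section Moments

variable {k ι : Type*} [Field k] [Fintype k] [Fintype ι] [DecidableEq ι]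

/-- The squarefree moment `∑ x, f x * ∏ i ∈ T, x i` of a function on `kⁱ`. -/
def moment (T : Finset ι) : ((ι → k) → k) →ₗ[k] k where
  toFun f := ∑ x, f x * ∏ i ∈ T, x i
  map_add' f g := by simp [add_mul, Finset.sum_add_distrib]
  map_smul' t f := by simp [Finset.mul_sum, mul_assoc]

theorem moment_apply (T : Finset ι) (f : (ι → k) → k) :
    moment T f = ∑ x, f x * ∏ i ∈ T, x i := rfl

theorem moment_translate (T : Finset ι) (f : (ι → k) → k) (a : ι → k) :
    moment T (fun x => f (x + a)) =
      ∑ U ∈ T.powerset, (∏ i ∈ T \ U, -a i) * moment U f := by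
  have h1 : moment T (fun x => f (x + a)) = ∑ x, f x * ∏ i ∈ T, (x i + -a i) := by
    rw [moment_apply]
    refine Fintype.sum_equiv (Equiv.addRight a) _ _ fun x => ?_
    simp
  rw [h1]
  simp only [Finset.prod_add, moment_apply, Finset.mul_sum]
  rw [Finset.sum_comm]
  exact Finset.sum_congr rfl fun U _ => Finset.sum_congr rfl fun x _ => by ring

theorem moment_translate_sub (T : Finset ι) (f : (ι → k) → k) (a : ι → k) :
    moment T ((fun x => f (x + a)) - f) =
      ∑ U ∈ T.ssubsets, (∏ i ∈ T \ U, -a i) * moment U f := by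
  rw [map_sub, moment_translate, Finset.ssubsets,
    ← Finset.add_sum_erase _ _ (Finset.mem_powerset_self T)]
  simp

/-- The functions dual to the squarefree moments. -/
def momentDual (k : Type*) [Field k] [DecidableEq k] (S : Finset ι) (x : ι → k) : k :=
  ∏ i, if i ∈ S then (if x i = 1 then 1 else 0) - (if x i = 0 then 1 else 0)
    else if x i = 0 then 1 else 0

theorem moment_momentDual [DecidableEq k] (T S : Finset ι) :
    moment T (momentDual k S) = if T = S then 1 else 0 := by
  have h1 : moment T (momentDual k S) = ∑ x : ι → k, ∏ i,
      ((if i ∈ S then (if x i = 1 then 1 else 0) - (if x i = 0 then 1 else 0)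
        else if x i = 0 then 1 else 0) * if i ∈ T then x i else 1) := by
    rw [moment_apply]
    refine Finset.sum_congr rfl fun x _ => ?_
    rw [Finset.prod_mul_distrib, Finset.prod_ite_mem, Finset.univ_inter]
    rfl
  have h2 := Finset.prod_univ_sum (fun _ : ι => (Finset.univ : Finset k)) fun i y =>
      ((if i ∈ S then (if y = 1 then 1 else 0) - (if y = 0 then 1 else 0)
        else if y = 0 then 1 else 0) * if i ∈ T then y else 1)
  rw [Fintype.piFinset_univ] at h2
  rw [h1, ← h2]
  have h3 : ∀ i, (∑ y : k, ((if i ∈ S then (if y = 1 then 1 else 0) - (if y = 0 then 1 else 0)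
        else if y = 0 then 1 else 0) * if i ∈ T then y else 1)) =
      if i ∈ T ↔ i ∈ S then 1 else 0 := fun i => by
    by_cases hS : i ∈ S <;> by_cases hT : i ∈ T <;> simp [hS, hT, sub_mul, Finset.sum_sub_distrib]
  rw [Finset.prod_congr rfl fun i _ => h3 i, Finset.prod_ite_zero]
  simp [Finset.ext_iff]

/-- The functions on `kⁱ` whose squarefree moments of degree at most `d` vanish. -/
def momentKer (k ι : Type*) [Field k] [Fintype k] [Fintype ι] [DecidableEq ι]
    (d : ℕ) : Submodule k ((ι → k) → k) :=
  LinearMap.ker (LinearMap.pi fun T : {T : Finset ι // T.card ≤ d} => moment (k := k) T.1)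

theorem mem_momentKer {d : ℕ} {f : (ι → k) → k} :
    f ∈ momentKer k ι d ↔ ∀ T : Finset ι, T.card ≤ d → moment T f = 0 := by
  simp [momentKer, funext_iff]

theorem card_le_finrank_momentKer_add (d : ℕ) :
    Fintype.card (ι → k) ≤ Module.finrank k (momentKer k ι d) +
      ∑ j ∈ Finset.range (d + 1), (Fintype.card ι).choose j := by
  have h1 := LinearMap.finrank_range_add_finrank_ker
    (LinearMap.pi fun T : {T : Finset ι // T.card ≤ d} => moment (k := k) T.1)
  have h2 := Submodule.finrank_le (LinearMap.range
    (LinearMap.pi fun T : {T : Finset ι // T.card ≤ d} => moment (k := k) T.1))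
  rw [Module.finrank_fintype_fun_eq_card] at h1 h2
  rw [card_finset_card_le] at h2
  rw [momentKer]
  omega

end Moments

theorem le_finrank_crossedHom_of_surjective {k G ι : Type*} [Field k] [Group G] [Fintype ι]
    [DecidableEq ι] (π : G →* Multiplicative (ι → k)) (hπ : Function.Surjective π)
    [FiniteDimensional k (crossedHom (Representation.trivial k G k))] :
    Fintype.card ι ≤ Module.finrank k (crossedHom (Representation.trivial k G k)) := by
  let R : (ι → k) →ₗ[k] crossedHom (Representation.trivial k G k) :=
    { toFun := fun a => ⟨fun g => ∑ i, a i * (π g).toAdd i, fun g h => by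
        simp [mul_add, Finset.sum_add_distrib]⟩
      map_add' := fun a b => by
        ext g
        simp [add_mul, Finset.sum_add_distrib]
      map_smul' := fun t a => by
        ext g
        simp [Finset.mul_sum, mul_assoc] }
  have hR : Function.Injective R := by
    rw [injective_iff_map_eq_zero]
    intro a ha
    funext i
    obtain ⟨g, hg⟩ := hπ (Multiplicative.ofAdd (Pi.single i 1))
    have : ∑ j, a j * (π g).toAdd j = 0 := congrFun (congrArg Subtype.val ha) g
    simpa [hg, Pi.single_apply] using this
  simpa using LinearMap.finrank_le_finrank_of_injective hR

theorem finiteDimensional_crossedHom_trivial {k G : Type*} [Field k] [Group G] [hG : Group.FG G] :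
    FiniteDimensional k (crossedHom (Representation.trivial k G k)) := by
  obtain ⟨S, hS⟩ := hG.out
  let R : crossedHom (Representation.trivial k G k) →ₗ[k] (S → k) :=
    { toFun := fun c s => c.1 s
      map_add' := fun _ _ => rfl
      map_smul' := fun _ _ => rfl }
  refine FiniteDimensional.of_injective R ((injective_iff_map_eq_zero _).2 fun c hc => ?_)
  refine Subtype.ext (funext fun g => ?_)
  have hg : g ∈ Subgroup.closure (S : Set G) := hS ▸ Subgroup.mem_top g
  change c.1 g = 0
  induction hg using Subgroup.closure_induction with
  | mem x hx => exact congrFun hc ⟨x, hx⟩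
  | one => exact crossedHom_one c.2
  | mul x y _ _ hx hy => rw [c.2, hx, hy]; simp
  | inv x _ hx => rw [crossedHom_inv c.2, hx]; simp

/-- The bound for each layer of the filtration by squarefree moments. -/
theorem add_mul_choose_le_firstBetti {G : Type u} [Group G] (P : FinitePresentation G)
    (hP : 1 ≤ P.deficiency) (p : ℕ) [Fact p.Prime] (r : ℕ) (N : Subgroup G)
    [Group.FG N] (π : G →* Multiplicative (Fin r → ZMod p)) (hπ : Function.Surjective π)
    (hN : ∀ g, g ∈ N ↔ π g = 1) (d : ℕ) :
    1 + firstBetti p G * r.choose d ≤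
      firstBetti p N + ∑ j ∈ Finset.range (d + 1), r.choose j := by
  have : FiniteDimensional (ZMod p) (crossedHom (Representation.trivial (ZMod p) N (ZMod p))) :=
    finiteDimensional_crossedHom_trivial
  rw [firstBetti_eq_finrank_crossedHom, firstBetti_eq_finrank_crossedHom]
  have h1 := finrank_crossedHom_translationRep_lt (k := ZMod p) π hπ N hN
  have h2 := card_le_finrank_momentKer_add (k := ZMod p) (ι := Fin r) d
  have h3 := P.finrank_crossedHom_ge (translationRep (ZMod p) π) (momentKer (ZMod p) (Fin r) d)
    (fun S : {S : Finset (Fin r) // S.card = d} => momentDual (ZMod p) S.1)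
    (fun g w hw => mem_momentKer.2 fun T hT => by
      change moment T (fun x => w (x + (π g).toAdd)) = 0
      rw [moment_translate]
      refine Finset.sum_eq_zero fun U hU => ?_
      rw [mem_momentKer.1 hw U ((Finset.card_le_card (Finset.mem_powerset.1 hU)).trans hT),
        mul_zero])
    (fun g S => mem_momentKer.2 fun T hT => by
      change moment T ((fun x => momentDual (ZMod p) S.1 (x + (π g).toAdd)) - _) = 0
      rw [moment_translate_sub]
      refine Finset.sum_eq_zero fun U hU => ?_
      have hlt := Finset.card_lt_card (Finset.mem_ssubsets.1 hU)
      rw [moment_momentDual, if_neg, mul_zero]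
      rintro rfl
      have := S.2
      omega)
    (fun a ha => by
      funext S
      have := mem_momentKer.1 ha S.1 S.2.le
      simpa [moment_momentDual, Subtype.val_inj] using this)
  have h4 : Fintype.card {S : Finset (Fin r) // S.card = d} = r.choose d := by
    simp
  rw [h4] at h3
  rw [Fintype.card_fin] at h2
  have h5 : P.numRels + 1 ≤ P.numGens := by
    unfold FinitePresentation.deficiency at hP
    omega
  have h6 := Nat.mul_le_mul_right (Module.finrank (ZMod p) (momentKer (ZMod p) (Fin r) d)) h5
  rw [add_mul, one_mul] at h6
  omega

theorem two_mul_sum_choose_le {r d : ℕ} (h : 2 * d ≤ r) :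
    2 * ∑ j ∈ Finset.range (d + 1), r.choose j ≤ 2 ^ r + r.choose d := by
  have h1 : ∑ j ∈ Finset.range d, r.choose j = ∑ j ∈ Finset.Ico (r + 1 - d) (r + 1), r.choose j := by
    rw [Finset.range_eq_Ico]
    refine Eq.trans ?_ (Finset.sum_Ico_reflect r.choose 0 (by omega : d ≤ r + 1))
    refine Finset.sum_congr rfl fun j hj => ?_
    rw [Nat.choose_symm (by have := Finset.mem_Ico.1 hj; omega)]
  have h2 : ∑ j ∈ Finset.range (d + 1), r.choose j +
      ∑ j ∈ Finset.Ico (r + 1 - d) (r + 1), r.choose j ≤ 2 ^ r := by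
    rw [← Nat.sum_range_choose, ← Finset.sum_union]
    · refine Finset.sum_le_sum_of_subset fun j hj => ?_
      simp only [Finset.mem_union, Finset.mem_range, Finset.mem_Ico] at hj ⊢
      omega
    · refine Finset.disjoint_left.2 fun j hj hj' => ?_
      simp only [Finset.mem_range, Finset.mem_Ico] at hj hj'
      omega
  rw [Finset.sum_range_succ] at h2 ⊢
  omega

theorem two_pow_le_two_add_mul_choose_middle {r : ℕ} (hr : 1 ≤ r) :
    2 ^ r ≤ 2 + (r - 1) * r.choose (r / 2) := by
  obtain ⟨s, rfl⟩ := Nat.exists_eq_add_of_le' hr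
  rw [← Nat.sum_range_choose, Finset.sum_range_succ, Finset.sum_range_succ']
  have := Finset.sum_le_card_nsmul (Finset.range s) (fun i => (s + 1).choose (i + 1)) _
    fun i _ => Nat.choose_le_middle (i + 1) (s + 1)
  simp only [Finset.card_range, smul_eq_mul] at this
  simp only [Nat.choose_zero_right, Nat.choose_self, Nat.add_sub_cancel]
  omega

theorem two_pow_add_sum_choose_lt {r : ℕ} (hr : 3 ≤ r) :
    2 ^ (r - 1) + ∑ j ∈ Finset.range (r / 2 + 1), r.choose j < 1 + r * r.choose (r / 2) := by
  have h1 := two_mul_sum_choose_le (Nat.mul_div_le r 2)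
  have h2 := two_pow_le_two_add_mul_choose_middle (by omega : 1 ≤ r)
  have h3 : r.choose 1 ≤ r.choose (r / 2) := Nat.choose_le_middle 1 r
  rw [Nat.choose_one_right] at h3
  obtain ⟨s, rfl⟩ := Nat.exists_eq_add_of_le' (by omega : 1 ≤ r)
  rw [pow_succ] at h1 h2
  simp only [Nat.add_sub_cancel, add_mul, one_mul] at h1 h2 ⊢
  omega

theorem theorem6p3 {G : Type u} [Group G] [Group.IsFinitelyPresented G]
    (hG : 1 ≤ groupDeficiency G) (p : ℕ) [Fact p.Prime] (r : ℕ) (hr : 1 ≤ r)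
    (N : Subgroup G) [N.Normal]
    (hN : Nonempty (G ⧸ N ≃* Multiplicative (Fin r → ZMod p))) :
    2 ^ (r - 1) ≤ firstBetti p N ∧
      (firstBetti p N = 2 ^ (r - 1) → firstBetti p G = r ∧ (r = 1 ∨ r = 2)) := by
  obtain ⟨P, hP⟩ := (le_groupDeficiency_iff G 1).1 (by simpa using hG)
  obtain ⟨e⟩ := hN
  let π : G →* Multiplicative (Fin r → ZMod p) := e.toMonoidHom.comp (QuotientGroup.mk' N)
  have hπ : Function.Surjective π := e.surjective.comp (QuotientGroup.mk'_surjective N)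
  have hker : ∀ g, g ∈ N ↔ π g = 1 := fun g => by
    change _ ↔ e (g : G ⧸ N) = 1
    rw [map_eq_one_iff _ e.injective, QuotientGroup.eq_one_iff]
  have hFG : Group.FG G := Group.fg_of_surjective P.proj_surjective
  have : Finite (Multiplicative (Fin r → ZMod p)) := inferInstanceAs (Finite (Fin r → ZMod p))
  have : Finite (G ⧸ N) := Finite.of_equiv _ e.symm.toEquiv
  have : N.FiniteIndex := Subgroup.finiteIndex_of_finite_quotient
  have hb : r ≤ firstBetti p G := by
    have : FiniteDimensional (ZMod p) (crossedHom (Representation.trivial (ZMod p) G (ZMod p))) :=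
      finiteDimensional_crossedHom_trivial
    rw [firstBetti_eq_finrank_crossedHom]
    simpa using le_finrank_crossedHom_of_surjective π hπ
  have key := add_mul_choose_le_firstBetti P hP p r N π hπ hker
  rcases (by omega : r = 1 ∨ r = 2 ∨ 3 ≤ r) with rfl | rfl | h3
  · have := key 0
    simp at this ⊢
    omega
  · have := key 0
    simp at this ⊢
    omega
  · have h1 := key (r / 2)
    have h2 := two_pow_add_sum_choose_lt h3
    have h4 := Nat.mul_le_mul_right (r.choose (r / 2)) hb
    omega
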